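/- **Proposition 4.3 (The different criterion).** Let $k$ be an algebraically closed field of characteristic $p>0$, let $R$ be a discrete valuation ring that is a finite extension of the ring of Witt vectors $W(k)$ (so the residue field of $R$ is $k$), and let $K=\operatorname{Frac}(R)$. Let $G$ be a finite group. A *$G$-extension* $B/A$ is a finite extension of integrally closed integral domains, with a $G$-action on $B$, such that $\operatorname{Frac}(B)/\operatorname{Frac}(A)$ is Galois with group $G$. Let $A/k[[t]]$ be a $G$-extension. A $G$-extension $A_R/R[[T]]$ is a *lift* of $A/k[[t]]$ if there is an isomorphism $A_R\otimes_R k\cong A$, compatible with the reduction map $R[[T]]\to k[[t]]$, $T \mapsto t$, under which the $G$-action on $A_R$ reduces to the given $G$-action on $A$. It is a *birational lift* of $A/k[[t]]$ if the integral closure of $A_R\otimes_R k$ in its total ring of fractions is isomorphic to $A$, compatibly with $R[[T]]\to k[[t]]$ and with the $G$-actions. Suppose $A_R/R[[T]]$ is a birational lift of $A/k[[t]]$. Let $\delta_s=\dim_k\left(A/\mathfrak D_s\right)$ be the degree of the different $\mathfrak D_s$ of $A/k[[t]]$, and let $\delta_\eta=\dim_K\left((A_R\otimes_R K)/\mathfrak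 D_\eta\right)$ be the degree, over $K$, of the different $\mathfrak D_\eta$ of $(A_R\otimes_R K)/(R[[T]]\otimes_R K)$. Then $$\delta_s\le\delta_\eta<\infty,$$ and $\delta_s=\delta_\eta$ if and only if $A_R/R[[T]]$ is a lift of $A/k[[t]]$. -/

import Mathlib

open scoped PowerSeries TensorProduct nonZeroDivisors

section Different

attribute [local instance] FractionRing.liftAlgebra FractionRing.isScalarTower_liftAlgebra

/-- The different of an extension `B / A` of integral domains: with `F = Frac A`, `L = Frac B`, it
is the ideal of all `b : B` such that `b • x ∈ B` for every `x : L` with `Tr_{L/F} (x B) ⊆ A`.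
This is Mathlib's `differentIdeal`, without the instance `IsDedekindDomain B`
among the arguments; see `different_eq_differentIdeal`. -/
noncomputable def different (A B : Type*) [CommRing A] [IsDomain A] [CommRing B] [IsDomain B]
    [Algebra A B] [Module.IsTorsionFree A B] : Ideal B :=
  (1 / Submodule.traceDual A (FractionRing A) 1 : Submodule B (FractionRing B)).comap
    (Algebra.linearMap B (FractionRing B))

theorem different_eq_differentIdeal (A B : Type*) [CommRing A] [IsDomain A] [CommRing B]
    [IsDedekindDomain B] [Algebra A B] [Module.IsTorsionFree A B] :
    different A B = differentIdeal A B := rfl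

/-- The degree over a base field `F` of the different `𝔇` of an extension `B / A` of `F`-algebras: the dimension of `B / 𝔇` over `F` (the length as an `F`-module, in `ℕ∞`). Equivalently,
it is the degree over `F` of the divisor of `𝔇`: every closed point counts with its residue degree
over `F`. If all residue degrees are `1` it is the length of `B / 𝔇` as a `B`-module. -/
noncomputable def differentDegree (F A B : Type*) [Field F] [CommRing A] [IsDomain A] [CommRing B]
    [IsDomain B] [Algebra A B] [Module.IsTorsionFree A B] [Algebra F B] : ℕ∞ :=
  Module.length F (B ⧸ different A B)

/-- `B / A` is a `G`-Galois extension of rings: a finite extension of integrally closed integral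
domains, with an action of `G` on `B` for which `Frac B / Frac A` is Galois with group `G`
(`G` acts faithfully on `Frac B`, with fixed field `Frac A`). It need not be étale. -/
structure IsGExtension (G A B : Type*) [Group G] [CommRing A] [IsDomain A] [CommRing B] [IsDomain B]
    [Algebra A B] [Module.IsTorsionFree A B] [MulSemiringAction G B] : Prop where
  finite : Module.Finite A B
  isIntegrallyClosed_base : IsIntegrallyClosed A
  isIntegrallyClosed : IsIntegrallyClosed B
  isGaloisGroup :
    letI := IsFractionRing.mulSemiringAction G B (FractionRing B)
    IsGaloisGroup G (FractionRing A) (FractionRing B)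

end Different

section GenericFiber

instance powerSeries_isTorsionFree (R : Type*) [CommRing R] [IsDomain R] :
    Module.IsTorsionFree R R⟦X⟧ :=
  Module.isTorsionFree_iff_algebraMap_injective.2 PowerSeries.C_injective

variable (R K A B : Type*) [CommRing R] [IsDomain R] [Field K] [Algebra R K] [IsFractionRing R K]
  [CommRing A] [IsDomain A] [Algebra R A] [Module.IsTorsionFree R A]
  [CommRing B] [IsDomain B] [Algebra R B] [Module.IsTorsionFree R B]
  [Algebra A B] [IsScalarTower R A B] [Module.IsTorsionFree A B]

instance genericFiber_isDomain : IsDomain (K ⊗[R] A) := by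
  let _ : Algebra A (K ⊗[R] A) := Algebra.TensorProduct.rightAlgebra
  have : IsLocalization (Algebra.algebraMapSubmonoid A R⁰) (K ⊗[R] A) := inferInstance
  exact IsLocalization.isDomain_of_le_nonZeroDivisors (R := A) (K ⊗[R] A)
    (M := Algebra.algebraMapSubmonoid A R⁰)
    (map_le_nonZeroDivisors_of_injective _ (FaithfulSMul.algebraMap_injective R A) le_rfl)

/-- The base change `K ⊗ B` as an algebra over the base change `K ⊗ A`. -/
noncomputable instance genericFiberAlgebra : Algebra (K ⊗[R] A) (K ⊗[R] B) :=
  (Algebra.TensorProduct.map (AlgHom.id K K) (IsScalarTower.toAlgHom R A B)).toRingHom.toAlgebra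

instance genericFiber_isTorsionFree : Module.IsTorsionFree (K ⊗[R] A) (K ⊗[R] B) := by
  have : Module.Flat R K := IsLocalization.flat K R⁰
  have hinj : Function.Injective (algebraMap (K ⊗[R] A) (K ⊗[R] B)) :=
    Module.Flat.lTensor_preserves_injective_linearMap (M := K)
      (IsScalarTower.toAlgHom R A B).toLinearMap (FaithfulSMul.algebraMap_injective A B)
  exact Module.isTorsionFree_iff_algebraMap_injective.2 hinj

end GenericFiber

section Lifts

open PowerSeries

variable (G R k AR A : Type*) [Group G] [CommRing R] [IsDomain R] [Field k] [Algebra R k]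
  [CommRing AR] [IsDomain AR] [Algebra R AR] [Algebra R⟦X⟧ AR]
  [Module.IsTorsionFree R⟦X⟧ AR] [MulSemiringAction G AR]
  [CommRing A] [Algebra k⟦X⟧ A] [MulSemiringAction G A]

/-- `AR / R⟦T⟧` is a lift of the `G`-extension `A / k⟦t⟧` (with `k` a quotient of `R`): it is a
`G`-extension, and there is an isomorphism of `AR ⊗ k` with `A`, over the reduction map
`R⟦T⟧ → k⟦t⟧`, that carries the reduction of the `G`-action on `AR` to the
given `G`-action on `A`. -/
structure IsLift : Prop where
  isGExtension : IsGExtension G R⟦X⟧ AR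
  exists_equiv : ∃ e : (k ⊗[R] AR) ≃+* A,
    (∀ f : R⟦X⟧, e (1 ⊗ₜ algebraMap R⟦X⟧ AR f) =
      algebraMap k⟦X⟧ A (PowerSeries.map (algebraMap R k) f)) ∧
    ∀ (g : G) (b : AR), e (1 ⊗ₜ (g • b)) = g • e (1 ⊗ₜ b)

/-- `AR / R⟦T⟧` is a birational lift of the `G`-extension `A / k⟦t⟧` (with `k` a quotient
of `R`): it is a `G`-extension, and there is an isomorphism of the integral closure of `AR ⊗ k` in
its total ring of fractions with `A`, over the reduction map `R⟦T⟧ → k⟦t⟧`, that is compatible with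
the `G`-actions. As `AR ⊗ k` generates its ring of fractions, compatibility
has to be tested only on the image of `AR`. -/
structure IsBirationalLift : Prop where
  isGExtension : IsGExtension G R⟦X⟧ AR
  exists_equiv : ∃ e : integralClosure (k ⊗[R] AR) (FractionRing (k ⊗[R] AR)) ≃+* A,
    (∀ f : R⟦X⟧, e (algebraMap (k ⊗[R] AR) _ (1 ⊗ₜ algebraMap R⟦X⟧ AR f)) =
      algebraMap k⟦X⟧ A (PowerSeries.map (algebraMap R k) f)) ∧
    ∀ (g : G) (b : AR), e (algebraMap (k ⊗[R] AR) _ (1 ⊗ₜ (g • b))) =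
      g • e (algebraMap (k ⊗[R] AR) _ (1 ⊗ₜ b))

end Lifts

/-! The birational lift gives an injection `ψ` of `k ⊗ AR` into `A`, which is an isomorphism
precisely when `AR` is a lift. The image of `AR` in `A` is finite and torsion-free over `k⟦X⟧`,
hence free. A basis of it lifts to an `R⟦X⟧`-basis `b` of `AR`
(`PowerSeries.exists_basis_of_reduction`). Let `M` be the trace matrix of `b`. Traces commute with
base change, so `M` gives the trace matrices on both fibres.

For any integral basis `c` of the fraction field of a Dedekind domain `E` with traces in `A₀`, with
dual basis `c'` and trace dual `I` of `E`, there is a chain `span c ≤ E ≤ I ≤ span c'`. The outer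
quotient is the cokernel of the trace matrix; the inner one has the same length as `E / I⁻¹`, which
is the degree of the different. So the degree is at most the length of the cokernel, and if that is
finite, equality means that `c` spans `E` (`differentDegree_le_length_coker`).

The reduction of `M` has nonzero determinant, because `Frac A` is separable over `Frac k⟦X⟧`.
Therefore the cokernel of `M` is torsion-free over `R`, and by Weierstrass division it is finite
over `R`; so it is free of some rank `r`. Its base changes to `k` and to `K` both have dimension `r`
(`PowerSeries.exists_length_coker_eq`). On the generic fibre the basis spans, so `δη = r`. On the
special fibre `δs ≤ r`, with equality precisely when the image of `AR` is all of `A`. -/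

/-! ### Completeness of `R` and Weierstrass division -/

/-- A finite module over an adically complete ring is precomplete. -/
theorem IsPrecomplete.of_finite {R : Type*} [CommRing R] (I : Ideal R) [IsAdicComplete I R]
    (M : Type*) [AddCommGroup M] [Module R M] [Module.Finite R M] : IsPrecomplete I M := by
  rw [← AdicCompletion.of_surjective_iff]
  intro y
  obtain ⟨x, rfl⟩ := AdicCompletion.ofTensorProduct_surjective_of_finite I M y
  induction x with
  | zero => exact ⟨0, by simp⟩
  | add x y hx hy =>
    obtain ⟨a, ha⟩ := hx
    obtain ⟨b, hb⟩ := hy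
    exact ⟨a + b, by simp [ha, hb]⟩
  | tmul r m =>
    obtain ⟨w, rfl⟩ := AdicCompletion.of_surjective I R r
    refine ⟨w • m, ?_⟩
    rw [AdicCompletion.ofTensorProduct_tmul]
    exact AdicCompletion.ext fun n => rfl

/-- Precompleteness for an ideal `I` implies that for an ideal `J` with `J ^ e ≤ I ≤ J`. -/
theorem IsPrecomplete.of_pow_le {R : Type*} [CommRing R] {I J : Ideal R} [IsPrecomplete I R]
    (e : ℕ) (he : J ^ e ≤ I) (hIJ : I ≤ J) : IsPrecomplete J R := by
  refine ⟨fun f hf => ?_⟩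
  simp only [smul_eq_mul, Ideal.mul_top, SModEq.sub_mem] at hf ⊢
  -- A `J`-Cauchy sequence has an `I`-Cauchy subsequence. The factor is `e + 1` and not `e`, so that
  -- `n ≤ (e + 1) * n` also when `e = 0`.
  have key : ∀ {m n : ℕ}, m ≤ n →
      f ((e + 1) * m) ≡ f ((e + 1) * n) [SMOD (I ^ m • ⊤ : Submodule R R)] := by
    intro m n h
    rw [SModEq.sub_mem, smul_eq_mul, Ideal.mul_top]
    have h1 := hf (Nat.mul_le_mul_left (e + 1) h)
    rw [pow_mul] at h1
    exact Ideal.pow_right_mono ((Ideal.pow_le_pow_right (Nat.le_succ e)).trans he) m h1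
  obtain ⟨L, hL⟩ := IsPrecomplete.prec ‹_› key
  refine ⟨L, fun n => ?_⟩
  have h1 := hL n
  rw [SModEq.sub_mem, smul_eq_mul, Ideal.mul_top] at h1
  have h2 := hf (show n ≤ (e + 1) * n by nlinarith)
  have := (J ^ n).add_mem h2 (Ideal.pow_right_mono hIJ n h1)
  simpa using this

/-- A discrete valuation ring that is finite over an adically complete ring is complete. -/
theorem IsDiscreteValuationRing.isAdicComplete_of_finite {W R : Type*} [CommRing W] (I : Ideal W)
    [IsAdicComplete I W] [CommRing R] [IsDomain R] [IsDiscreteValuationRing R] [Algebra W R]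
    [Module.Finite W R] (h0 : I.map (algebraMap W R) ≠ ⊥)
    (h1 : I.map (algebraMap W R) ≤ IsLocalRing.maximalIdeal R) :
    IsAdicComplete (IsLocalRing.maximalIdeal R) R := by
  have : IsPrecomplete I R := .of_finite I R
  have : IsPrecomplete (I.map (algebraMap W R)) R := IsPrecomplete.map_algebraMap_iff.2 this
  obtain ⟨ϖ, hϖ⟩ := IsDiscreteValuationRing.exists_irreducible R
  obtain ⟨e, he⟩ := IsDiscreteValuationRing.ideal_eq_span_pow_irreducible h0 hϖ
  have : IsPrecomplete (IsLocalRing.maximalIdeal R) R := by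
    refine IsPrecomplete.of_pow_le (I := I.map (algebraMap W R)) e ?_ h1
    rw [he, hϖ.maximalIdeal_eq, Ideal.span_singleton_pow]
  exact {}

/-- Weierstrass division: a quotient of `R⟦X⟧` by a power series that is nonzero modulo the maximal
ideal is a finite `R`-module. -/
theorem PowerSeries.finite_quotient_span_singleton {R : Type*} [CommRing R] [IsLocalRing R]
    [IsAdicComplete (IsLocalRing.maximalIdeal R) R] (d : R⟦X⟧)
    (hd : PowerSeries.map (IsLocalRing.residue R) d ≠ 0) :
    Module.Finite R (R⟦X⟧ ⧸ Ideal.span {d}) := by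
  set n := (PowerSeries.map (IsLocalRing.residue R) d).order.toNat
  let f : Polynomial.degreeLT R n →ₗ[R] (R⟦X⟧ ⧸ Ideal.span {d}) :=
    ((Ideal.Quotient.mkₐ R (Ideal.span {d})).toLinearMap ∘ₗ
      (Polynomial.coeToPowerSeries.algHom (R := R) R).toLinearMap) ∘ₗ Submodule.subtype _
  have : Module.Finite R (Polynomial.degreeLT R n) :=
    Module.Finite.equiv (Polynomial.degreeLTEquiv R n).symm
  -- Every class is represented by its Weierstrass remainder, a polynomial of degree less than `n`.
  refine Module.Finite.of_surjective f fun y => ?_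
  obtain ⟨y, rfl⟩ := Ideal.Quotient.mk_surjective y
  obtain ⟨q, r, hr, h⟩ := PowerSeries.exists_isWeierstrassDivision y hd
  refine ⟨⟨r, Polynomial.mem_degreeLT.2 hr⟩, ?_⟩
  change Ideal.Quotient.mk _ ((Polynomial.coeToPowerSeries.algHom (R := R) R) r) = _
  rw [Eq.comm, Ideal.Quotient.mk_eq_mk_iff_sub_mem, Ideal.mem_span_singleton, h]
  exact ⟨q, by simp⟩

/-! ### Lengths of subquotients -/

namespace Submodule

variable {F V : Type*} [Ring F] [AddCommGroup V] [Module F V]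

/-- The length of the subquotient `Q / P` of `V` (where `P ≤ Q`). -/
noncomputable def relLength (P Q : Submodule F V) : ℕ∞ := Module.length F (Q ⧸ P.submoduleOf Q)

/-- Moves a quotient into a common ambient module, where lengths can be compared along chains of
submodules. -/
theorem length_quotient_eq_relLength {X : Type*} [AddCommGroup X] [Module F X] (f : X →ₗ[F] V)
    {N : Submodule F X} {P Q : Submodule F V} (hQ : LinearMap.range f = Q) (hN : P.comap f = N) :
    Module.length F (X ⧸ N) = relLength P Q := by
  subst hQ hN
  refine LinearEquiv.length_eq ((Submodule.quotEquivOfEq _ _ ?_).trans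
    (LinearMap.quotKerEquivOfSurjective
      ((P.submoduleOf (LinearMap.range f)).mkQ ∘ₗ f.rangeRestrict)
      ((Submodule.mkQ_surjective _).comp f.surjective_rangeRestrict)))
  ext x
  exact (Submodule.Quotient.mk_eq_zero (P.submoduleOf (LinearMap.range f))
    (x := f.rangeRestrict x)).symm

/-- Additivity of length on the exact sequence `0 → Q/P → T/P → T/Q → 0`. -/
theorem relLength_add {P Q T : Submodule F V} (h1 : P ≤ Q) (h2 : Q ≤ T) :
    relLength P T = relLength P Q + relLength Q T := by
  refine Module.length_eq_add_of_exact
    ((P.submoduleOf Q).mapQ (P.submoduleOf T) (Submodule.inclusion h2) (fun x hx => hx))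
    ((P.submoduleOf T).mapQ (Q.submoduleOf T) LinearMap.id (fun x hx => h1 hx)) ?_ ?_ ?_
  · rw [← LinearMap.ker_eq_bot, LinearMap.ker_eq_bot']
    intro x hx
    obtain ⟨x, rfl⟩ := Submodule.mkQ_surjective _ x
    exact (Submodule.Quotient.mk_eq_zero _).2
      ((Submodule.Quotient.mk_eq_zero (P.submoduleOf T) (x := Submodule.inclusion h2 x)).1 hx)
  · intro x
    obtain ⟨x, rfl⟩ := Submodule.mkQ_surjective _ x
    exact ⟨Submodule.Quotient.mk x, rfl⟩
  · intro x
    obtain ⟨x, rfl⟩ := Submodule.mkQ_surjective _ x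
    refine (Submodule.Quotient.mk_eq_zero (Q.submoduleOf T) (x := x)).trans ?_
    constructor
    · intro hx
      exact ⟨Submodule.Quotient.mk ⟨x, hx⟩, rfl⟩
    · rintro ⟨y, hy⟩
      obtain ⟨y, rfl⟩ := Submodule.mkQ_surjective _ y
      have := (Submodule.Quotient.eq (P.submoduleOf T) (x := Submodule.inclusion h2 y)).1 hy
      have h3 : ((Submodule.inclusion h2 y - x : T) : V) ∈ P := this
      have h4 := Q.sub_mem y.2 (h1 h3)
      simpa [Submodule.submoduleOf] using h4

theorem relLength_eq_zero_iff {P Q : Submodule F V} : relLength P Q = 0 ↔ Q ≤ P := by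
  rw [relLength, Module.length_eq_zero_iff, Submodule.Quotient.subsingleton_iff,
    Submodule.submoduleOf_eq_top]

theorem relLength_le_of_le {P P' Q Q' : Submodule F V} (h1 : P ≤ P') (h2 : P' ≤ Q') (h3 : Q' ≤ Q) :
    relLength P' Q' ≤ relLength P Q := by
  rw [relLength_add (h1.trans h2) h3, relLength_add h1 h2]
  exact le_add_self.trans le_self_add

/-- The lengths of `P'/P` and `Q/Q'` add up to the difference of the two sides, which vanishes;
finiteness is what permits the cancellation in `ℕ∞`. -/
theorem eq_of_relLength_eq {P P' Q Q' : Submodule F V} (h1 : P ≤ P') (h2 : P' ≤ Q') (h3 : Q' ≤ Q)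
    (hfin : relLength P Q ≠ ⊤) (h : relLength P' Q' = relLength P Q) : P = P' := by
  rw [relLength_add (h1.trans h2) h3, relLength_add h1 h2] at h hfin
  refine le_antisymm h1 (relLength_eq_zero_iff.1 ?_)
  generalize relLength P P' = a at *
  generalize relLength P' Q' = b at *
  generalize relLength Q' Q = c at *
  have hb : b ≠ ⊤ := by rintro rfl; simp at hfin
  have ha : a ≠ ⊤ := by rintro rfl; simp at hfin
  have hc : c ≠ ⊤ := by rintro rfl; simp at hfin
  lift a to ℕ using ha
  lift b to ℕ using hb
  lift c to ℕ using hc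
  norm_cast at h ⊢
  omega

end Submodule

/-! ### Fractional ideals and their inverses -/

section Dedekind

variable {E L : Type*} [CommRing E] [IsDedekindDomain E] [Field L] [Algebra E L]
  [IsFractionRing E L]

/-- A fractional ideal of a Dedekind domain that contains `1` is generated by `1` and one
further element. -/
theorem IsDedekindDomain.exists_sup_span_one_eq (I : Submodule E L) (h1 : 1 ≤ I)
    (hI : IsFractional E⁰ I) : ∃ x : L, I = 1 ⊔ Submodule.span E {x} := by
  obtain ⟨c, hc, hcI⟩ := hI
  have hc0 : algebraMap E L c ≠ 0 :=
    IsFractionRing.to_map_ne_zero_of_mem_nonZeroDivisors hc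
  let f : L →ₗ[E] L := LinearMap.lsmul E L c
  -- Clearing the denominator turns `I` into the ideal `J = c I`. It contains `c` because `1 ∈ I`,
  -- so it is generated by `c` and one further `a`; then `x = a / c`.
  let J : Ideal E := (I.map f).comap (Algebra.linearMap E L)
  have hmem : ∀ e, e ∈ J ↔ ∃ y ∈ I, c • y = algebraMap E L e := fun e => by
    simp [J, f]
  have hcJ : Ideal.span {c} ≤ J := by
    rw [Ideal.span_singleton_le_iff_mem, hmem]
    exact ⟨1, h1 (Submodule.mem_one.2 ⟨1, map_one _⟩), by rw [Algebra.smul_def, mul_one]⟩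
  obtain ⟨a, ha⟩ := IsDedekindDomain.exists_sup_span_eq hcJ
    (by simpa using nonZeroDivisors.ne_zero hc)
  refine ⟨algebraMap E L a / algebraMap E L c, le_antisymm (fun y hy => ?_) (sup_le h1 ?_)⟩
  · obtain ⟨e, he⟩ := hcI y hy
    have heJ : e ∈ J := (hmem e).2 ⟨y, hy, he.symm⟩
    rw [← ha, Ideal.mem_span_singleton_sup] at heJ
    obtain ⟨u, v, hv, rfl⟩ := heJ
    obtain ⟨w, rfl⟩ := Ideal.mem_span_singleton'.1 hv
    rw [Submodule.mem_sup]
    refine ⟨algebraMap E L u, Submodule.mem_one.2 ⟨u, rfl⟩, _,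
      Submodule.smul_mem _ w (Submodule.mem_span_singleton_self _), ?_⟩
    rw [Algebra.smul_def] at he ⊢
    simp only [map_add, map_mul] at he
    field_simp
    linear_combination he
  · rw [Submodule.span_singleton_le_iff_mem]
    have : a ∈ J := ha ▸ Ideal.mem_sup_right (Ideal.mem_span_singleton_self a)
    obtain ⟨y, hy, h⟩ := (hmem a).1 this
    rw [Algebra.smul_def] at h
    rwa [← h, mul_div_cancel_left₀ _ hc0]

/-- For a fractional ideal `I ⊇ E` of a Dedekind domain `E`, the quotients `E / I⁻¹` and `I / E`
have the same length over any base field. -/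
theorem IsDedekindDomain.length_quotient_comap_one_div (F : Type*) [Field F] [Algebra F E]
    [Module F L] [IsScalarTower F E L] (I : Submodule E L) (h1 : 1 ≤ I) (hI : IsFractional E⁰ I) :
    Module.length F (E ⧸ (1 / I : Submodule E L).comap (Algebra.linearMap E L)) =
      Submodule.relLength ((1 : Submodule E L).restrictScalars F) (I.restrictScalars F) := by
  obtain ⟨x, hx⟩ := exists_sup_span_one_eq I h1 hI
  have hxI : x ∈ I := hx ▸ Submodule.mem_sup_right (Submodule.mem_span_singleton_self x)
  -- Multiplication by `x` maps `E` onto `I / E`, since `I = E + E x`. An element `b` is in the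
  -- kernel when `b x ∈ E`, which is the same as `b I ≤ E`.
  let g : E →ₗ[E] (I ⧸ (1 : Submodule E L).submoduleOf I) :=
    (Submodule.mkQ _) ∘ₗ LinearMap.toSpanSingleton E I ⟨x, hxI⟩
  have hg : ∀ b, g b = Submodule.Quotient.mk (b • ⟨x, hxI⟩) := fun b => rfl
  have hsurj : Function.Surjective g := by
    intro y
    obtain ⟨⟨y, hy⟩, rfl⟩ := Submodule.mkQ_surjective _ y
    have hy' := hy
    rw [hx, Submodule.mem_sup] at hy'
    obtain ⟨u, hu, v, hv, rfl⟩ := hy'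
    obtain ⟨b, rfl⟩ := Submodule.mem_span_singleton.1 hv
    refine ⟨b, ?_⟩
    rw [hg, Submodule.mkQ_apply, eq_comm, Submodule.Quotient.eq]
    simpa [Submodule.submoduleOf] using hu
  have hker : (1 / I : Submodule E L).comap (Algebra.linearMap E L) = LinearMap.ker g := by
    ext b
    rw [LinearMap.mem_ker, hg, Submodule.Quotient.mk_eq_zero, Submodule.mem_comap,
      Submodule.mem_div_iff_forall_mul_mem]
    simp only [Algebra.linearMap_apply, ← Algebra.smul_def]
    refine ⟨fun h => h x hxI, fun h y hy => ?_⟩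
    rw [hx, Submodule.mem_sup] at hy
    obtain ⟨u, hu, v, hv, rfl⟩ := hy
    obtain ⟨w, rfl⟩ := Submodule.mem_span_singleton.1 hv
    rw [smul_add, smul_comm b w]
    exact add_mem (Submodule.smul_mem _ _ hu) (Submodule.smul_mem _ _ h)
  let e := (Submodule.quotEquivOfEq _ _ hker).trans (g.quotKerEquivOfSurjective hsurj)
  rw [(e.restrictScalars F).length_eq]
  exact LinearEquiv.length_eq (LinearEquiv.refl F _)

end Dedekind

/-! ### Trace matrices, dual lattices and the different -/

section TraceDual

variable {A₀ F₀ L ι : Type*} [CommRing A₀] [Field F₀] [Field L] [Algebra A₀ F₀]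
  [Algebra A₀ L] [Algebra F₀ L] [IsScalarTower A₀ F₀ L]

/-- An element of `L` whose traces against a basis lie in `A₀` is an `A₀`-combination of
the dual basis. -/
theorem Algebra.mem_span_dualBasis_of_trace [Finite ι] [DecidableEq ι]
    (hnd : (Algebra.traceForm F₀ L).Nondegenerate)
    (c : Module.Basis ι F₀ L) (x : L)
    (hx : ∀ i, Algebra.trace F₀ L (x * c i) ∈ (algebraMap A₀ F₀).range) :
    x ∈ Submodule.span A₀ (Set.range ((Algebra.traceForm F₀ L).dualBasis hnd c)) := by
  have := Fintype.ofFinite ι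
  rw [← Module.Basis.sum_repr ((Algebra.traceForm F₀ L).dualBasis hnd c) x]
  refine Submodule.sum_mem _ fun i _ => ?_
  obtain ⟨a, ha⟩ := hx i
  rw [LinearMap.BilinForm.dualBasis_repr_apply, Algebra.traceForm_apply, ← ha, algebraMap_smul]
  exact Submodule.smul_mem _ _ (Submodule.subset_span ⟨i, rfl⟩)

/-- The cokernel of the trace matrix of a basis is the quotient of the dual lattice by the lattice
spanned by the basis. -/
theorem Algebra.length_coker_traceMatrix [Fintype ι] [DecidableEq ι] [FaithfulSMul A₀ F₀]
    (F : Type*) [CommRing F] [Algebra F A₀] [Module F L] [IsScalarTower F A₀ L]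
    (hnd : (Algebra.traceForm F₀ L).Nondegenerate)
    (c : Module.Basis ι F₀ L) (M : Matrix ι ι A₀)
    (hM : ∀ i j, algebraMap A₀ F₀ (M i j) = Algebra.trace F₀ L (c i * c j)) :
    Module.length F ((ι → A₀) ⧸ LinearMap.range M.mulVecLin) =
      Submodule.relLength ((Submodule.span A₀ (Set.range c)).restrictScalars F)
        ((Submodule.span A₀ (Set.range
          ((Algebra.traceForm F₀ L).dualBasis hnd c))).restrictScalars F) := by
  set c' := (Algebra.traceForm F₀ L).dualBasis hnd c with hc'
  have hli : LinearIndependent A₀ c' := by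
    refine c'.linearIndependent.restrict_scalars ?_
    simpa [Algebra.smul_def] using FaithfulSMul.algebraMap_injective A₀ F₀
  -- `θ` identifies `A₀^ι` with the dual lattice. The columns of `M` are the coordinates of the `c
  -- j` in the dual basis, so the range of `M` goes to the span of `c`.
  let θ : (ι → A₀) →ₗ[A₀] L := Fintype.linearCombination A₀ c'
  have hθinj : Function.Injective θ := LinearIndependent.fintypeLinearCombination_injective hli
  have hc : ∀ j, c j = ∑ i, M i j • c' i := fun j => by
    rw [← c'.sum_repr (c j)]
    refine Finset.sum_congr rfl fun i _ => ?_
    rw [hc', LinearMap.BilinForm.dualBasis_repr_apply, Algebra.traceForm_apply, mul_comm, ← hM,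
      algebraMap_smul]
  have hθM : ∀ w, θ (M.mulVecLin w) = Fintype.linearCombination A₀ c w := fun w => by
    simp only [θ, Fintype.linearCombination_apply, Matrix.mulVecLin_apply, Matrix.mulVec,
      dotProduct, hc, Finset.smul_sum, Finset.sum_smul, smul_smul]
    rw [Finset.sum_comm]
    exact Finset.sum_congr rfl fun j _ => Finset.sum_congr rfl fun i _ => by rw [mul_comm]
  have h := Submodule.length_quotient_eq_relLength (θ.restrictScalars F)
    (N := (LinearMap.range M.mulVecLin).restrictScalars F)
    (P := (Submodule.span A₀ (Set.range c)).restrictScalars F)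
    (Q := (Submodule.span A₀ (Set.range c')).restrictScalars F) ?_ ?_
  · rw [← h]
    exact LinearEquiv.length_eq (LinearEquiv.refl F _)
  · ext x
    rw [Submodule.restrictScalars_mem, ← Fintype.range_linearCombination]
    rfl
  · ext v
    simp only [Submodule.mem_comap, Submodule.restrictScalars_mem, LinearMap.restrictScalars_apply,
      ← Fintype.range_linearCombination A₀ (v := c), LinearMap.mem_range, ← hθM]
    exact exists_congr fun w => hθinj.eq_iff

end TraceDual

section DifferentDegree

attribute [local instance] FractionRing.liftAlgebra FractionRing.isScalarTower_liftAlgebra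

variable {F A₀ E ι : Type*} [Field F] [CommRing A₀] [IsDomain A₀] [CommRing E] [IsDedekindDomain E]
  [Algebra A₀ E] [Module.IsTorsionFree A₀ E] [Algebra F A₀] [Algebra F E] [IsScalarTower F A₀ E]

/-- The degree of the different is at most the length of the cokernel of the trace matrix of any
integral basis of the fraction fields; if this is finite, equality holds precisely if the basis
spans `E`. -/
theorem differentDegree_le_length_coker [Fintype ι] [DecidableEq ι] (e : ι → E)
    (c : Module.Basis ι (FractionRing A₀) (FractionRing E))
    (hc : ∀ i, c i = algebraMap E (FractionRing E) (e i))
    (htr : ∀ x : E, Algebra.trace (FractionRing A₀) (FractionRing E)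
      (algebraMap E (FractionRing E) x) ∈ (algebraMap A₀ (FractionRing A₀)).range)
    (M : Matrix ι ι A₀) (hdet : M.det ≠ 0)
    (hM : ∀ i j, algebraMap A₀ (FractionRing A₀) (M i j) =
      Algebra.trace (FractionRing A₀) (FractionRing E) (c i * c j)) :
    differentDegree F A₀ E ≤ Module.length F ((ι → A₀) ⧸ LinearMap.range M.mulVecLin) ∧
    (Submodule.span A₀ (Set.range e) = ⊤ →
      differentDegree F A₀ E = Module.length F ((ι → A₀) ⧸ LinearMap.range M.mulVecLin)) ∧
    (Module.length F ((ι → A₀) ⧸ LinearMap.range M.mulVecLin) ≠ ⊤ →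
      differentDegree F A₀ E = Module.length F ((ι → A₀) ⧸ LinearMap.range M.mulVecLin) →
      Submodule.span A₀ (Set.range e) = ⊤) := by
  set L := FractionRing E
  set F₀ := FractionRing A₀
  have hnd : (Algebra.traceForm F₀ L).Nondegenerate := by
    refine LinearMap.BilinForm.nondegenerate_of_det_ne_zero _ c ?_
    have : LinearMap.BilinForm.toMatrix c (Algebra.traceForm F₀ L) =
        M.map (algebraMap A₀ F₀) := by
      ext i j
      rw [LinearMap.BilinForm.toMatrix_apply, Matrix.map_apply]
      exact (hM i j).symm
    rw [this, ← RingHom.mapMatrix_apply, ← RingHom.map_det]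
    simpa using hdet
  set c' := (Algebra.traceForm F₀ L).dualBasis hnd c with hc'
  set I : Submodule E L := Submodule.traceDual A₀ F₀ 1 with hI
  -- The upper end of the chain `span c ≤ E ≤ I ≤ span c'`: the coordinates in `c'` are the traces
  -- against `c`, whose members lie in `E`.
  have hIc : I.restrictScalars A₀ ≤ Submodule.span A₀ (Set.range c') := fun x hx => by
    refine Algebra.mem_span_dualBasis_of_trace hnd c x fun i => ?_
    rw [hc, ← Algebra.traceForm_apply]
    exact Submodule.mem_traceDual.1 hx _ (Submodule.mem_one.2 ⟨_, rfl⟩)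
  have h1I : 1 ≤ I := by
    intro x hx
    refine Submodule.mem_traceDual.2 fun a ha => ?_
    obtain ⟨x, rfl⟩ := Submodule.mem_one.1 hx
    obtain ⟨a, rfl⟩ := Submodule.mem_one.1 ha
    rw [Algebra.traceForm_apply, ← map_mul]
    exact htr _
  -- A common denominator of the finite family `c'` is one for `I`.
  have hfrac : IsFractional E⁰ I := by
    obtain ⟨a, ha⟩ := IsLocalization.exist_integer_multiples_of_finite E⁰ c'
    refine ⟨a, a.2, fun x hx => ?_⟩
    have hx' := hIc hx
    clear hx
    induction hx' using Submodule.span_induction with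
    | mem x h => obtain ⟨i, rfl⟩ := h; exact ha i
    | zero => rw [smul_zero]; exact IsLocalization.isInteger_zero
    | add x y _ _ hx hy => rw [smul_add]; exact IsLocalization.isInteger_add hx hy
    | smul r x _ hx =>
      rw [smul_comm, ← algebraMap_smul E r]
      exact IsLocalization.isInteger_smul hx
  have hcE : Submodule.span A₀ (Set.range c) ≤ (1 : Submodule E L).restrictScalars A₀ := by
    rw [Submodule.span_le]
    rintro _ ⟨i, rfl⟩
    exact Submodule.mem_one.2 ⟨e i, (hc i).symm⟩
  have hD : differentDegree F A₀ E =
      Submodule.relLength ((1 : Submodule E L).restrictScalars F) (I.restrictScalars F) :=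
    IsDedekindDomain.length_quotient_comap_one_div F I h1I hfrac
  have hC := Algebra.length_coker_traceMatrix F hnd c M hM
  rw [hD, hC]
  have hspan : Submodule.span A₀ (Set.range e) = ⊤ ↔
      (1 : Submodule E L).restrictScalars A₀ ≤ Submodule.span A₀ (Set.range c) := by
    have : Set.range c = (IsScalarTower.toAlgHom A₀ E L).toLinearMap '' Set.range e := by
      rw [← Set.range_comp]
      exact congrArg Set.range (funext hc)
    rw [this, Submodule.span_image, eq_top_iff]
    constructor
    · intro h x hx
      obtain ⟨x, rfl⟩ := Submodule.mem_one.1 hx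
      exact Submodule.mem_map_of_mem (h trivial)
    · intro h x _
      obtain ⟨y, hy, hxy⟩ := h (show algebraMap E L x ∈ _ from Submodule.mem_one.2 ⟨x, rfl⟩)
      rwa [← IsFractionRing.injective E L hxy]
  refine ⟨Submodule.relLength_le_of_le hcE h1I hIc, fun h => ?_, fun hfin h => ?_⟩
  · have h1 : (1 : Submodule E L).restrictScalars A₀ = Submodule.span A₀ (Set.range c) :=
      le_antisymm (hspan.1 h) hcE
    have hI2 : I.restrictScalars A₀ = Submodule.span A₀ (Set.range c') := by
      refine le_antisymm hIc ?_
      rw [Submodule.span_le]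
      rintro _ ⟨i, rfl⟩
      refine Submodule.mem_traceDual.2 fun a ha => ?_
      have ha' : a ∈ Submodule.span A₀ (Set.range c) := h1 ▸ ha
      clear ha
      induction ha' using Submodule.span_induction with
      | mem x h =>
        obtain ⟨j, rfl⟩ := h
        rw [LinearMap.BilinForm.apply_dualBasis_left]
        split_ifs
        · exact ⟨1, map_one _⟩
        · exact ⟨0, map_zero _⟩
      | zero => rw [map_zero]; exact ⟨0, map_zero _⟩
      | add x y _ _ hx hy =>
        rw [map_add]
        exact add_mem hx hy
      | smul r x _ hx =>
        rw [← algebraMap_smul F₀ r x, map_smul, smul_eq_mul]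
        exact mul_mem ⟨r, rfl⟩ hx
    have e1 : (1 : Submodule E L).restrictScalars F =
        (Submodule.span A₀ (Set.range c)).restrictScalars F :=
      SetLike.ext' (congrArg (fun N : Submodule A₀ L => (N : Set L)) h1)
    have e2 : I.restrictScalars F = (Submodule.span A₀ (Set.range c')).restrictScalars F :=
      SetLike.ext' (congrArg (fun N : Submodule A₀ L => (N : Set L)) hI2)
    rw [e1, e2]
  · have := Submodule.eq_of_relLength_eq (P := (Submodule.span A₀ (Set.range c)).restrictScalars F)
      (P' := (1 : Submodule E L).restrictScalars F) (Q' := I.restrictScalars F) hcE h1I hIc hfin h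
    exact hspan.2 fun x hx => (this ▸ hx : x ∈ (Submodule.span A₀ (Set.range c)).restrictScalars F)

end DifferentDegree

/-! ### Cokernels of matrices over `R⟦X⟧` and their base changes -/

/-- If the cokernel `Q` of a matrix over an `R`-algebra `S` is free over `R`, then the cokernel of
its base change to a field `F` has length the rank of `Q`. -/
theorem Matrix.length_coker_map {R S F S' ι Q : Type*} [CommRing R] [Nontrivial R] [CommRing S]
    [Algebra R S] [Field F] [Algebra R F] [CommRing S'] [Algebra F S'] [Fintype ι] [DecidableEq ι]
    (M : Matrix ι ι S) (f : S →+* S') (e : F ⊗[R] S ≃ₗ[F] S') (he : ∀ s, e (1 ⊗ₜ s) = f s)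
    [AddCommGroup Q] [Module R Q] [Module.Free R Q] [Module.Finite R Q]
    (q : (ι → S) →ₗ[R] Q) (hq0 : ∀ v, q v = 0 ↔ v ∈ LinearMap.range M.mulVecLin)
    (hq : Function.Surjective q) :
    Module.length F ((ι → S') ⧸ LinearMap.range (M.map f).mulVecLin) = Module.finrank R Q := by
  have hex : Function.Exact (M.mulVecLin.restrictScalars R) q := hq0
  let E : (F ⊗[R] (ι → S)) ≃ₗ[F] (ι → S') :=
    (TensorProduct.piRight R F F (fun _ : ι => S)).trans (LinearEquiv.piCongrRight fun _ => e)
  have he' : ∀ (a : F) (s : S), e (a ⊗ₜ s) = a • f s := fun a s => by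
    rw [← he, ← map_smul, TensorProduct.smul_tmul', smul_eq_mul, mul_one]
  have hE : ∀ (a : F) (v : ι → S) (i : ι), E (a ⊗ₜ v) i = a • f (v i) := fun a v i => by
    simp [E, he']
  have hcomm : ∀ x, E (LinearMap.lTensor F (M.mulVecLin.restrictScalars R) x) =
      (M.map f).mulVecLin (E x) := by
    intro x
    induction x with
    | zero => simp only [map_zero]
    | add x y hx hy => rw [map_add, map_add, hx, hy, map_add, map_add]
    | tmul a v =>
      ext i
      rw [LinearMap.lTensor_tmul, hE]
      simp only [LinearMap.restrictScalars_apply, Matrix.mulVecLin_apply, Matrix.mulVec,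
        dotProduct, hE, map_sum, Finset.smul_sum, Matrix.map_apply, map_mul, mul_smul_comm]
  let g : (ι → S') →ₗ[F] F ⊗[R] Q := q.baseChange F ∘ₗ E.symm.toLinearMap
  have hg : Function.Surjective g :=
    (LinearMap.lTensor_surjective F hq).comp E.symm.surjective
  -- Right exactness of the tensor product: the cokernel of the base change is `F ⊗ Q`.
  have hker : (LinearMap.range (M.map f).mulVecLin).restrictScalars F = LinearMap.ker g := by
    ext v
    have h1 := lTensor_exact F hex hq (E.symm v)
    change _ ↔ LinearMap.lTensor F q (E.symm v) = 0
    rw [h1]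
    constructor
    · rintro ⟨w, rfl⟩
      refine ⟨E.symm w, E.injective ?_⟩
      rw [E.apply_symm_apply]
      exact (hcomm _).trans (by rw [E.apply_symm_apply])
    · rintro ⟨w, hw⟩
      refine ⟨E w, ?_⟩
      rw [← hcomm, ← E.apply_symm_apply v]
      exact congrArg E hw
  rw [← (Submodule.Quotient.restrictScalarsEquiv F
    (LinearMap.range (M.map f).mulVecLin)).length_eq,
    (Submodule.quotEquivOfEq _ _ hker).length_eq, (g.quotKerEquivOfSurjective hg).length_eq,
    Module.length_eq_finrank, Module.finrank_baseChange]

section PowerSeries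

variable {R k ι : Type*} [CommRing R] [Field k] [Algebra R k] [Fintype ι] [DecidableEq ι]

theorem PowerSeries.exists_eq_C_mul_of_map_eq_zero {ϖ : R}
    (hϖ : ∀ r : R, algebraMap R k r = 0 ↔ ϖ ∣ r) (s : R⟦X⟧)
    (hs : PowerSeries.map (algebraMap R k) s = 0) : ∃ s' : R⟦X⟧, s = PowerSeries.C ϖ * s' := by
  have h : ∀ n, ∃ c, PowerSeries.coeff n s = ϖ * c := fun n => (hϖ _).1 <| by
    rw [← PowerSeries.coeff_map, hs, map_zero]
  choose c hc using h
  exact ⟨PowerSeries.mk c, by ext n; simp [hc]⟩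

variable [IsDomain R] [IsDiscreteValuationRing R]

/-- A square matrix over `R⟦X⟧` whose determinant is nonzero over `k⟦X⟧` has a cokernel that is
torsion-free over `R`. -/
theorem PowerSeries.isTorsionFree_coker {ϖ : R} (hirr : Irreducible ϖ)
    (hϖ : ∀ r : R, algebraMap R k r = 0 ↔ ϖ ∣ r)
    (M : Matrix ι ι R⟦X⟧) (hM : (M.map (PowerSeries.map (algebraMap R k))).det ≠ 0) :
    Module.IsTorsionFree R ((ι → R⟦X⟧) ⧸ LinearMap.range M.mulVecLin) := by
  -- If `ϖ y = M x`, the reduction of `x` is killed by a matrix of nonzero determinant, so `x = ϖ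
  -- x'`; cancelling `ϖ` gives `y = M x'`.
  have key : ∀ q : (ι → R⟦X⟧) ⧸ LinearMap.range M.mulVecLin, ϖ • q = 0 → q = 0 := by
    intro q hq
    obtain ⟨y, rfl⟩ := Submodule.mkQ_surjective _ q
    have hq' : ϖ • y ∈ LinearMap.range M.mulVecLin := (Submodule.Quotient.mk_eq_zero _).1 hq
    obtain ⟨x, hx⟩ := hq'
    have hx0 : (PowerSeries.map (algebraMap R k)) ∘ x = 0 := by
      refine Matrix.eq_zero_of_mulVec_eq_zero hM ?_
      ext1 i
      rw [← RingHom.map_mulVec, ← Matrix.mulVecLin_apply, hx]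
      simp [PowerSeries.smul_eq_C_mul, (hϖ ϖ).2 dvd_rfl]
    have := fun i => exists_eq_C_mul_of_map_eq_zero hϖ (x i) (congrFun hx0 i)
    choose x' hx' using this
    refine (Submodule.Quotient.mk_eq_zero _).2 ⟨x', ?_⟩
    have hxx : x = (PowerSeries.C ϖ : R⟦X⟧) • x' := funext hx'
    have hC : (PowerSeries.C ϖ : R⟦X⟧) ≠ 0 := fun h =>
      hirr.ne_zero (PowerSeries.C_injective (h.trans (map_zero _).symm))
    rw [hxx, map_smul] at hx
    ext1 i
    refine mul_left_cancel₀ hC ?_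
    have := congrFun hx i
    rw [Pi.smul_apply, Pi.smul_apply, PowerSeries.smul_eq_C_mul] at this
    exact this
  refine Module.IsTorsionFree.of_smul_eq_zero fun r q hrq => or_iff_not_imp_left.2 fun hr => ?_
  obtain ⟨n, u, rfl⟩ := IsDiscreteValuationRing.eq_unit_mul_pow_irreducible hr hirr
  rw [mul_smul] at hrq
  have h2 : ϖ ^ n • q = 0 := by
    have := congrArg (fun z => (↑u⁻¹ : R) • z) hrq
    simpa [smul_smul] using this
  clear hrq hr
  induction n with
  | zero => simpa using h2
  | succ n ih => exact ih (key _ (by rwa [smul_smul, ← pow_succ']))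

/-- A finite `R⟦X⟧`-module (with `R` complete) that is killed by a power series which is nonzero
over the residue field is finite over `R`. -/
theorem PowerSeries.finite_of_smul_eq_zero {R Q : Type*} [CommRing R] [IsLocalRing R]
    [IsAdicComplete (IsLocalRing.maximalIdeal R) R]
    [AddCommGroup Q] [Module R⟦X⟧ Q] [Module R Q] [IsScalarTower R R⟦X⟧ Q]
    [Module.Finite R⟦X⟧ Q] (d : R⟦X⟧) (hd : PowerSeries.map (IsLocalRing.residue R) d ≠ 0)
    (h : ∀ q : Q, d • q = 0) : Module.Finite R Q := by
  have := PowerSeries.finite_quotient_span_singleton d hd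
  obtain ⟨n, g, hg⟩ := Module.Finite.exists_fin (R := R⟦X⟧) (M := Q)
  -- `Q` is a quotient of `(R⟦X⟧ / d)^n`, which is finite over `R`.
  let f (i : Fin n) : (R⟦X⟧ ⧸ Ideal.span {d}) →ₗ[R⟦X⟧] Q :=
    Submodule.liftQ _ (LinearMap.toSpanSingleton R⟦X⟧ Q (g i)) <| by
      rw [Ideal.span_singleton_le_iff_mem, LinearMap.mem_ker, LinearMap.toSpanSingleton_apply, h]
  refine Module.Finite.of_surjective
    ((LinearMap.lsum R⟦X⟧ (fun _ : Fin n => R⟦X⟧ ⧸ Ideal.span {d}) ℕ f).restrictScalars R) ?_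
  intro q
  have hq : q ∈ Submodule.span R⟦X⟧ (Set.range g) := hg ▸ trivial
  obtain ⟨c, rfl⟩ := (Submodule.mem_span_range_iff_exists_fun _).1 hq
  refine ⟨fun i => Submodule.Quotient.mk (c i), ?_⟩
  simp only [LinearMap.restrictScalars_apply, LinearMap.lsum_apply, LinearMap.sum_apply,
    LinearMap.comp_apply, LinearMap.proj_apply]
  exact Finset.sum_congr rfl fun _ _ => rfl

/-- The cokernel of a square matrix is killed by the determinant. -/
theorem Matrix.det_smul_coker {S ι : Type*} [CommRing S] [Fintype ι] [DecidableEq ι]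
    (M : Matrix ι ι S) (q : (ι → S) ⧸ LinearMap.range M.mulVecLin) : M.det • q = 0 := by
  obtain ⟨y, rfl⟩ := Submodule.mkQ_surjective _ q
  refine (Submodule.Quotient.mk_eq_zero _).2 ⟨M.adjugate.mulVec y, ?_⟩
  rw [Matrix.mulVecLin_apply, Matrix.mulVec_mulVec, Matrix.mul_adjugate, Matrix.smul_mulVec,
    Matrix.one_mulVec]

/-- Passes from the given field `k` to the canonical residue field of `R`, for which Weierstrass
division is stated. -/
theorem PowerSeries.map_residue_ne_zero (hk : ∀ r : R, ¬ IsUnit r → algebraMap R k r = 0)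
    {s : R⟦X⟧} (hs : PowerSeries.map (algebraMap R k) s ≠ 0) :
    PowerSeries.map (IsLocalRing.residue R) s ≠ 0 := by
  contrapose! hs
  ext n
  rw [PowerSeries.coeff_map, map_zero]
  refine hk _ ?_
  have : IsLocalRing.residue R (PowerSeries.coeff n s) = 0 := by
    rw [← PowerSeries.coeff_map, hs, map_zero]
  rwa [IsLocalRing.residue_eq_zero_iff] at this

/-- `k ⊗ R⟦X⟧ ≃ k⟦X⟧` for the residue field `k` of a discrete valuation ring `R`. -/
theorem PowerSeries.exists_tensorProduct_equiv {R k : Type*} [CommRing R] [Field k] [Algebra R k]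
    {ϖ : R} (hϖ : ∀ r : R, algebraMap R k r = 0 ↔ ϖ ∣ r)
    (hsurj : Function.Surjective (algebraMap R k)) :
    ∃ e : k ⊗[R] R⟦X⟧ ≃ₗ[k] k⟦X⟧, ∀ s, e (1 ⊗ₜ s) = PowerSeries.map (algebraMap R k) s := by
  let l : R⟦X⟧ →ₗ[R] k⟦X⟧ :=
    { toFun := PowerSeries.map (algebraMap R k)
      map_add' := map_add _
      map_smul' := fun r s => by
        ext n
        simp [Algebra.smul_def, PowerSeries.algebraMap_apply] }
  -- As `R → k` is onto, every tensor is of the form `1 ⊗ₜ s`. Injectivity can then be tested on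
  -- these: if `s` reduces to zero, it is a multiple of `ϖ`.
  have hrep : ∀ x : k ⊗[R] R⟦X⟧, ∃ s : R⟦X⟧, x = 1 ⊗ₜ s := fun x => by
    induction x with
    | zero => exact ⟨0, by simp⟩
    | add x y hx hy =>
      obtain ⟨s, rfl⟩ := hx
      obtain ⟨t, rfl⟩ := hy
      exact ⟨s + t, by rw [TensorProduct.tmul_add]⟩
    | tmul a s =>
      obtain ⟨r, rfl⟩ := hsurj a
      exact ⟨r • s, by rw [TensorProduct.tmul_smul, TensorProduct.smul_tmul', Algebra.smul_def,
        mul_one]⟩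
  have hl : ∀ s : R⟦X⟧, l.liftBaseChange k (1 ⊗ₜ s) = PowerSeries.map (algebraMap R k) s :=
    fun s => by rw [LinearMap.liftBaseChange_tmul, one_smul]; rfl
  refine ⟨LinearEquiv.ofBijective (l.liftBaseChange k) ⟨?_, fun y => ?_⟩, hl⟩
  · rw [← LinearMap.ker_eq_bot, LinearMap.ker_eq_bot']
    intro x hx
    obtain ⟨s, rfl⟩ := hrep x
    rw [hl] at hx
    obtain ⟨s', rfl⟩ := exists_eq_C_mul_of_map_eq_zero hϖ s hx
    rw [← PowerSeries.smul_eq_C_mul, TensorProduct.tmul_smul, TensorProduct.smul_tmul',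
      Algebra.smul_def, (hϖ ϖ).2 dvd_rfl, zero_mul, TensorProduct.zero_tmul]
  · obtain ⟨s, rfl⟩ := PowerSeries.map_surjective _ hsurj y
    exact ⟨1 ⊗ₜ s, hl s⟩

/-- The cokernels of the reduction and of the generic fibre of a square matrix over `R⟦X⟧`, with
nonzero determinant over the residue field `k`, have the same finite length. -/
theorem PowerSeries.exists_length_coker_eq [IsAdicComplete (IsLocalRing.maximalIdeal R) R]
    {ϖ : R} (hirr : Irreducible ϖ) (hϖ : ∀ r : R, algebraMap R k r = 0 ↔ ϖ ∣ r)
    (hsurj : Function.Surjective (algebraMap R k))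
    (M : Matrix ι ι R⟦X⟧) (hM : (M.map (PowerSeries.map (algebraMap R k))).det ≠ 0)
    (K : Type*) [Field K] [Algebra R K] :
    ∃ r : ℕ, Module.length k ((ι → k⟦X⟧) ⧸
        LinearMap.range (M.map (PowerSeries.map (algebraMap R k))).mulVecLin) = r ∧
      Module.length K ((ι → K ⊗[R] R⟦X⟧) ⧸ LinearMap.range (M.map
        (Algebra.TensorProduct.includeRight : R⟦X⟧ →ₐ[R] K ⊗[R] R⟦X⟧)).mulVecLin) = r := by
  have h1 := PowerSeries.isTorsionFree_coker hirr hϖ M hM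
  have h2 : Module.Finite R ((ι → R⟦X⟧) ⧸ LinearMap.range M.mulVecLin) := by
    refine PowerSeries.finite_of_smul_eq_zero M.det
      (PowerSeries.map_residue_ne_zero (k := k) (fun r hr => (hϖ r).2 ?_) ?_) M.det_smul_coker
    · rwa [← Ideal.mem_span_singleton, ← hirr.maximalIdeal_eq, IsLocalRing.mem_maximalIdeal]
    · rwa [RingHom.map_det, RingHom.mapMatrix_apply]
  obtain ⟨e, he⟩ := PowerSeries.exists_tensorProduct_equiv hϖ hsurj
  let q : (ι → R⟦X⟧) →ₗ[R] ((ι → R⟦X⟧) ⧸ LinearMap.range M.mulVecLin) :=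
    (Submodule.mkQ (LinearMap.range M.mulVecLin)).restrictScalars R
  have hex : ∀ v, q v = 0 ↔ v ∈ LinearMap.range M.mulVecLin := fun v =>
    Submodule.Quotient.mk_eq_zero _
  have hq : Function.Surjective q := Submodule.mkQ_surjective (LinearMap.range M.mulVecLin)
  -- The witness is the rank over `R` of the cokernel, which is free because it is finite and
  -- torsion-free over a discrete valuation ring.
  exact ⟨_, Matrix.length_coker_map M _ e he q hex hq,
    Matrix.length_coker_map M
      (Algebra.TensorProduct.includeRight : R⟦X⟧ →ₐ[R] K ⊗[R] R⟦X⟧).toRingHom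
      (LinearEquiv.refl K _) (fun _ => rfl) q hex hq⟩

end PowerSeries

/-! ### Reduction modulo `ϖ`, traces and bases -/

/-- If `k` is a quotient of `R` by a principal ideal `(ϖ)`, the kernel of `N → k ⊗ N` is `ϖ N`. -/
theorem TensorProduct.exists_eq_smul_of_one_tmul_eq_zero {R k N : Type*} [CommRing R] [CommRing k]
    [Algebra R k] [AddCommGroup N] [Module R N] {ϖ : R}
    (hϖ : ∀ r : R, algebraMap R k r = 0 ↔ ϖ ∣ r)
    (hsurj : Function.Surjective (algebraMap R k)) (b : N) (hb : (1 : k) ⊗ₜ[R] b = 0) :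
    ∃ b' : N, b = ϖ • b' := by
  -- The claim comes from tensoring the exact sequence `R → R → k → 0`, with first map
  -- multiplication by `ϖ`, with `N`.
  have hex : Function.Exact (LinearMap.lsmul R R ϖ) (Algebra.linearMap R k) := fun r => by
    rw [Algebra.linearMap_apply, hϖ]
    exact exists_congr fun c => eq_comm
  have h := (rTensor_exact N hex hsurj (1 ⊗ₜ b)).1
    (by rw [LinearMap.rTensor_tmul, Algebra.linearMap_apply, map_one, hb])
  obtain ⟨x, hx⟩ := h
  refine ⟨TensorProduct.lid R N x, ?_⟩
  have h2 : ∀ x : R ⊗[R] N, TensorProduct.lid R N (LinearMap.rTensor N (LinearMap.lsmul R R ϖ) x) =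
      ϖ • TensorProduct.lid R N x := fun x => by
    induction x with
    | zero => simp
    | add x y hx hy => rw [map_add, map_add, hx, hy, map_add, smul_add]
    | tmul a n => simp [mul_smul]
  rw [← h2, hx, TensorProduct.lid_tmul, one_smul]

/-- Traces are compatible with maps of algebras that carry a basis to a basis. -/
theorem Algebra.trace_map_of_basis {S B S' B' ι : Type*} [CommRing S] [CommRing B] [Algebra S B]
    [CommRing S'] [CommRing B'] [Algebra S' B'] [Finite ι] (f : S →+* S') (φ : B →+* B')
    (hφ : ∀ s, φ (algebraMap S B s) = algebraMap S' B' (f s))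
    (b : Module.Basis ι S B) (b' : Module.Basis ι S' B') (hb : ∀ i, b' i = φ (b i)) (x : B) :
    Algebra.trace S' B' (φ x) = f (Algebra.trace S B x) := by
  classical
  have := Fintype.ofFinite ι
  have hrepr : ∀ (y : B) (i : ι), b'.repr (φ y) i = f (b.repr y i) := fun y i => by
    have : φ y = ∑ j, f (b.repr y j) • b' j := by
      conv_lhs => rw [← b.sum_repr y]
      simp only [Algebra.smul_def, map_sum, map_mul, hφ, hb]
    rw [this, map_sum, Finsupp.finsetSum_apply]
    simp [Finsupp.single_apply]
  rw [Algebra.trace_eq_matrix_trace b, Algebra.trace_eq_matrix_trace b', Matrix.trace, Matrix.trace,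
    map_sum]
  refine Finset.sum_congr rfl fun i _ => ?_
  simp only [Matrix.diag_apply, Algebra.leftMulMatrix_eq_repr_mul, hb, ← map_mul, hrepr]

section FractionRing

attribute [local instance] FractionRing.liftAlgebra FractionRing.isScalarTower_liftAlgebra

/-- A linearly independent family of the right size in a finite extension `E / A₀` of domains is a
basis of the fraction fields. -/
theorem LinearIndependent.exists_basis_fractionRing {A₀ E ι : Type*} [CommRing A₀] [IsDomain A₀]
    [CommRing E] [IsDomain E] [Algebra A₀ E] [Module.IsTorsionFree A₀ E] [Module.Finite A₀ E]
    [Fintype ι] (e : ι → E) (he : LinearIndependent A₀ e)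
    (hcard : Fintype.card ι = Module.finrank (FractionRing A₀) (FractionRing E)) :
    ∃ c : Module.Basis ι (FractionRing A₀) (FractionRing E),
      ∀ i, c i = algebraMap E (FractionRing E) (e i) := by
  have hli : LinearIndependent (FractionRing A₀) (fun i => algebraMap E (FractionRing E) (e i)) := by
    rw [← LinearIndependent.iff_fractionRing A₀]
    exact he.map' (IsScalarTower.toAlgHom A₀ E (FractionRing E)).toLinearMap
      (LinearMap.ker_eq_bot.2 (IsFractionRing.injective E (FractionRing E)))
  rcases isEmpty_or_nonempty ι with hι | hι
  · have hfin : FiniteDimensional (FractionRing A₀) (FractionRing E) :=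
      inferInstance
    have : 0 < Module.finrank (FractionRing A₀) (FractionRing E) := Module.finrank_pos
    rw [← hcard, Fintype.card_eq_zero] at this
    exact absurd this (lt_irrefl _)
  · exact ⟨basisOfLinearIndependentOfCardEqFinrank hli hcard, fun i => by simp⟩

end FractionRing

/-- Let `B` be a finite torsion-free `R⟦X⟧`-algebra whose reduction `B / ϖ B` is embedded, over
`R⟦X⟧ → k⟦X⟧`, in a torsion-free `k⟦X⟧`-algebra `A`. Then `B` is free, and any basis remains
linearly independent in `A`. -/
theorem PowerSeries.exists_basis_of_reduction {R k B A : Type*} [CommRing R] [IsDomain R]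
    [IsDiscreteValuationRing R] [Field k] [Algebra R k] {ϖ : R} (hirr : Irreducible ϖ)
    (hϖ : ∀ r : R, algebraMap R k r = 0 ↔ ϖ ∣ r) (hsurj : Function.Surjective (algebraMap R k))
    [CommRing B] [Algebra R⟦X⟧ B] [Module.Finite R⟦X⟧ B] [Module.IsTorsionFree R⟦X⟧ B]
    [CommRing A] [Algebra k⟦X⟧ A] [Module.IsTorsionFree k⟦X⟧ A] (φ : B →+* A)
    (hφ : ∀ s, φ (algebraMap R⟦X⟧ B s) =
      algebraMap k⟦X⟧ A (PowerSeries.map (algebraMap R k) s))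
    (hker : ∀ b, φ b = 0 → ∃ b', b = (PowerSeries.C ϖ : R⟦X⟧) • b') :
    ∃ (n : ℕ) (b : Module.Basis (Fin n) R⟦X⟧ B), LinearIndependent k⟦X⟧ (φ ∘ b) := by
  have hsm : ∀ (s : R⟦X⟧) (b : B), φ (s • b) = PowerSeries.map (algebraMap R k) s • φ b :=
    fun s b => by rw [Algebra.smul_def, map_mul, hφ, Algebra.smul_def]
  have hmap := PowerSeries.map_surjective _ hsurj
  let C : Submodule k⟦X⟧ A :=
    { carrier := Set.range φ
      add_mem' := by
        rintro _ _ ⟨x, rfl⟩ ⟨y, rfl⟩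
        exact ⟨x + y, map_add _ _ _⟩
      zero_mem' := ⟨0, map_zero _⟩
      smul_mem' := by
        rintro f _ ⟨x, rfl⟩
        obtain ⟨s, rfl⟩ := hmap f
        exact ⟨s • x, hsm s x⟩ }
  have hCfin : Module.Finite k⟦X⟧ C := by
    obtain ⟨t, ht⟩ := Module.Finite.fg_top (R := R⟦X⟧) (M := B)
    classical
    refine Module.Finite.iff_fg.2 ⟨t.image φ, le_antisymm ?_ ?_⟩
    · rw [Submodule.span_le]
      intro x hx
      obtain ⟨y, -, rfl⟩ := Finset.mem_image.1 hx
      exact ⟨y, rfl⟩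
    · rintro _ ⟨x, rfl⟩
      have hx : x ∈ Submodule.span R⟦X⟧ (t : Set B) := ht ▸ trivial
      induction hx using Submodule.span_induction with
      | mem x h => exact Submodule.subset_span (Finset.mem_image_of_mem _ h)
      | zero => rw [map_zero]; exact zero_mem _
      | add x y _ _ hx hy => rw [map_add]; exact add_mem hx hy
      | smul s x _ hx => rw [hsm]; exact Submodule.smul_mem _ _ hx
  -- The image `C` of `φ` is finite and torsion-free over the principal ideal domain `k⟦X⟧`, hence
  -- free.
  let c := Module.finBasis k⟦X⟧ C
  set n := Module.finrank k⟦X⟧ C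
  have hc : ∀ i, ∃ b, φ b = c i := fun i => (c i).2
  choose b hb using hc
  have hli' : LinearIndependent k⟦X⟧ (φ ∘ b) := by
    have : φ ∘ b = C.subtype ∘ c := funext hb
    rw [this]
    exact c.linearIndependent.map' C.subtype C.ker_subtype
  have hC0 : (PowerSeries.C ϖ : R⟦X⟧) ≠ 0 := fun h =>
    hirr.ne_zero (PowerSeries.C_injective (h.trans (map_zero _).symm))
  -- A relation among the `b i` reduces to a relation among the independent `φ (b i)`, so its
  -- coefficients are divisible by `ϖ`. Dividing by `ϖ` gives another relation, and the argument
  -- repeats.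
  have hdvd : ∀ (m : ℕ) (g : Fin n → R⟦X⟧), ∑ i, g i • b i = 0 →
      ∀ i j, ϖ ^ m ∣ PowerSeries.coeff j (g i) := by
    intro m
    induction m with
    | zero => intro g _ i j; simp
    | succ m ih =>
      intro g hg i j
      have h0 : ∀ i, PowerSeries.map (algebraMap R k) (g i) = 0 := by
        refine Fintype.linearIndependent_iff.1 hli' _ ?_
        rw [← map_zero φ, ← hg, map_sum]
        exact Finset.sum_congr rfl fun i _ => (hsm _ _).symm
      choose g' hg' using fun i => PowerSeries.exists_eq_C_mul_of_map_eq_zero hϖ (g i) (h0 i)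
      have hg0 : ∑ i, g' i • b i = 0 := by
        have : (PowerSeries.C ϖ : R⟦X⟧) • ∑ i, g' i • b i = 0 := by
          rw [← hg, Finset.smul_sum]
          exact Finset.sum_congr rfl fun i _ => by rw [smul_smul, hg' i]
        exact (smul_eq_zero.1 this).resolve_left hC0
      rw [hg' i, PowerSeries.coeff_C_mul, pow_succ']
      exact mul_dvd_mul_left _ (ih g' hg0 i j)
  have hli : LinearIndependent R⟦X⟧ b := by
    refine Fintype.linearIndependent_iff.2 fun g hg i => ?_
    ext j
    rw [map_zero]
    by_contra hne
    obtain ⟨m, hm⟩ := FiniteMultiplicity.of_not_isUnit hirr.not_isUnit hne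
    exact hm (hdvd (m + 1) g hg i j)
  have hspan : ⊤ ≤ Submodule.span R⟦X⟧ (Set.range b) := by
    -- Nakayama's lemma: `ϖ` lies in the Jacobson radical of `R⟦X⟧`, and the `b i` generate `B`
    -- modulo `ϖ`.
    refine Submodule.le_of_le_smul_of_le_jacobson_bot (I := Ideal.span {PowerSeries.C ϖ})
      Module.Finite.fg_top ?_ ?_
    · rw [Ideal.span_singleton_le_iff_mem, Ideal.mem_jacobson_bot]
      intro y
      rw [PowerSeries.isUnit_iff_constantCoeff]
      simp only [map_add, map_mul, map_one, PowerSeries.constantCoeff_C]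
      have : ϖ ∈ IsLocalRing.maximalIdeal R := hirr.not_isUnit
      have h3 : ϖ ∈ (⊥ : Ideal R).jacobson := by
        rwa [IsLocalRing.jacobson_eq_maximalIdeal _ bot_ne_top]
      exact Ideal.mem_jacobson_bot.1 h3 _
    · intro x _
      have hx : φ x ∈ C := ⟨x, rfl⟩
      have hsum := c.sum_repr ⟨φ x, hx⟩
      choose s hs using fun i => hmap (c.repr ⟨φ x, hx⟩ i)
      have h0 : φ (x - ∑ i, s i • b i) = 0 := by
        rw [map_sub, map_sum, sub_eq_zero]
        have := congrArg C.subtype hsum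
        rw [map_sum] at this
        refine this.symm.trans (Finset.sum_congr rfl fun i _ => ?_)
        rw [hsm, hb, hs, map_smul]
        rfl
      obtain ⟨b', hb'⟩ := hker _ h0
      rw [← sub_add_cancel x (∑ i, s i • b i), add_comm]
      refine Submodule.add_mem_sup
        (Submodule.sum_mem _ fun i _ => Submodule.smul_mem _ _ (Submodule.subset_span ⟨i, rfl⟩)) ?_
      rw [hb']
      exact Submodule.smul_mem_smul (Ideal.mem_span_singleton_self _) trivial
  refine ⟨n, Module.Basis.mk hli hspan, ?_⟩
  rwa [Module.Basis.coe_mk]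

/-! ### The generic fibre: bases and the Dedekind property -/

section GenericFiber

variable (R K A B : Type*) [CommRing R] [Field K] [Algebra R K]
  [CommRing A] [Algebra R A] [CommRing B] [Algebra R B] [Algebra A B] [IsScalarTower R A B]

theorem genericFiber_algebraMap_tmul (x : K) (a : A) :
    algebraMap (K ⊗[R] A) (K ⊗[R] B) (x ⊗ₜ a) = x ⊗ₜ algebraMap A B a := rfl

theorem genericFiber_isScalarTower : IsScalarTower K (K ⊗[R] A) (K ⊗[R] B) :=
  IsScalarTower.of_algebraMap_eq fun x => by
    rw [Algebra.TensorProduct.algebraMap_apply, Algebra.TensorProduct.algebraMap_apply,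
      genericFiber_algebraMap_tmul, map_one]

/-- The base change to the generic fibre of a basis. -/
theorem genericFiber_exists_basis {ι : Type*} [Finite ι] (b : Module.Basis ι A B) :
    ∃ b' : Module.Basis ι (K ⊗[R] A) (K ⊗[R] B), ∀ i, b' i = 1 ⊗ₜ b i := by
  classical
  have := Fintype.ofFinite ι
  let Φ : (K ⊗[R] B) ≃ₗ[K] (ι → K ⊗[R] A) :=
    (TensorProduct.AlgebraTensorModule.congr (LinearEquiv.refl K K)
      (b.equivFun.restrictScalars R)).trans (TensorProduct.piRight R K K (fun _ : ι => A))
  let Ψ : (ι → K ⊗[R] A) →ₗ[K ⊗[R] A] K ⊗[R] B :=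
    Fintype.linearCombination (K ⊗[R] A) (fun i => (1 : K) ⊗ₜ b i)
  have hΨΦ : ∀ x, Ψ (Φ x) = x := fun x => by
    induction x with
    | zero => rw [map_zero, map_zero]
    | add x y hx hy => rw [map_add, map_add, hx, hy]
    | tmul a y =>
      have h1 : Φ (a ⊗ₜ y) = fun i => a ⊗ₜ b.repr y i := rfl
      rw [h1, Fintype.linearCombination_apply]
      conv_rhs => rw [← b.sum_repr y, TensorProduct.tmul_sum]
      refine Finset.sum_congr rfl fun i _ => ?_
      rw [Algebra.smul_def, genericFiber_algebraMap_tmul, Algebra.TensorProduct.tmul_mul_tmul,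
        mul_one, Algebra.smul_def]
  -- `Φ` is known to be bijective but is only `K`-linear; `Ψ` is linear over `K ⊗ A` and is its
  -- inverse.
  have hbij : Function.Bijective Ψ := by
    have : (Ψ : (ι → K ⊗[R] A) → K ⊗[R] B) = Φ.symm := funext fun v => by
      rw [← hΨΦ (Φ.symm v), Φ.apply_symm_apply]
    rw [this]
    exact Φ.symm.bijective
  refine ⟨Module.Basis.ofEquivFun (LinearEquiv.ofBijective Ψ hbij).symm, fun i => ?_⟩
  rw [Module.Basis.coe_ofEquivFun, LinearEquiv.symm_symm]
  change Ψ (Pi.single i 1) = _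
  simp [Ψ, Fintype.linearCombination_apply, Pi.single_apply]

end GenericFiber

/-- The generic fibre of a finite normal `R⟦X⟧`-algebra is a Dedekind domain. -/
theorem genericFiber_isDedekindDomain (R K B : Type*) [CommRing R] [IsDomain R]
    [IsDiscreteValuationRing R] [IsAdicComplete (IsLocalRing.maximalIdeal R) R]
    [Field K] [Algebra R K] [IsFractionRing R K]
    [CommRing B] [IsDomain B] [Algebra R B] [Module.IsTorsionFree R B]
    [Algebra R⟦X⟧ B] [IsScalarTower R R⟦X⟧ B] [Module.IsTorsionFree R⟦X⟧ B]
    [Module.Finite R⟦X⟧ B] [IsIntegrallyClosed B] : IsDedekindDomain (K ⊗[R] B) := by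
  let _ : Algebra B (K ⊗[R] B) := Algebra.TensorProduct.rightAlgebra
  have hloc : IsLocalization (Algebra.algebraMapSubmonoid B R⁰) (K ⊗[R] B) := inferInstance
  have hle : Algebra.algebraMapSubmonoid B R⁰ ≤ B⁰ :=
    map_le_nonZeroDivisors_of_injective _ (FaithfulSMul.algebraMap_injective R B) le_rfl
  have hBN : IsNoetherianRing B := IsNoetherianRing.of_finite R⟦X⟧ B
  have hN : IsNoetherianRing (K ⊗[R] B) :=
    IsLocalization.isNoetherianRing (Algebra.algebraMapSubmonoid B R⁰) _ hBN
  have hIC : IsIntegrallyClosed (K ⊗[R] B) :=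
    isIntegrallyClosed_of_isLocalization _ (Algebra.algebraMapSubmonoid B R⁰) hle
  -- A nonzero prime `P` contracts to a prime `p` of `B` that contains some `f : R⟦X⟧` with nonzero
  -- reduction. By Weierstrass division `B / p` is finite over `R`, so the quotient by `P` is a
  -- domain integral over `K`, hence a field.
  have hdim : Ring.DimensionLEOne (K ⊗[R] B) := ⟨by
    intro P hP0 hP
    obtain ⟨ϖ, hirr⟩ := IsDiscreteValuationRing.exists_irreducible R
    have hinj : Function.Injective (algebraMap B (K ⊗[R] B)) :=
      IsLocalization.injective _ hle
    set p := P.comap (algebraMap B (K ⊗[R] B)) with hp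
    have hp0 : p ≠ ⊥ := fun h => hP0 <| by
      rw [← IsLocalization.map_under (Algebra.algebraMapSubmonoid B R⁰) (K ⊗[R] B) P]
      change Ideal.map _ p = ⊥
      rw [h, Ideal.map_bot]
    have hpS : p.comap (algebraMap R⟦X⟧ B) ≠ ⊥ := mt Ideal.eq_bot_of_comap_eq_bot hp0
    have hϖp : PowerSeries.C ϖ ∉ p.comap (algebraMap R⟦X⟧ B) := fun h => by
      have h1 : (1 : K) ⊗ₜ[R] (algebraMap R⟦X⟧ B (PowerSeries.C ϖ)) ∈ P := h
      have h2 : algebraMap R⟦X⟧ B (PowerSeries.C ϖ) = ϖ • (1 : B) := by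
        rw [← algebraMap_smul R⟦X⟧ ϖ (1 : B), Algebra.smul_def, mul_one]
        rfl
      rw [h2, TensorProduct.tmul_smul, ← algebraMap_smul K, TensorProduct.smul_tmul',
        smul_eq_mul, mul_one] at h1
      have hϖK : algebraMap R K ϖ ≠ 0 := by simpa using hirr.ne_zero
      refine hP.ne_top ((Ideal.eq_top_iff_one _).2 ?_)
      have := P.mul_mem_left ((algebraMap R K ϖ)⁻¹ ⊗ₜ 1) h1
      rwa [Algebra.TensorProduct.tmul_mul_tmul, inv_mul_cancel₀ hϖK, one_mul] at this
    have hprime : (p.comap (algebraMap R⟦X⟧ B)).IsPrime := inferInstance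
    obtain ⟨f, hf, hf0⟩ : ∃ f ∈ p.comap (algebraMap R⟦X⟧ B),
        PowerSeries.map (IsLocalRing.residue R) f ≠ 0 := by
      -- Otherwise every element of the contracted prime is `ϖ` times a power series, which is again
      -- in the prime because `ϖ` is not; so every coefficient is divisible by all powers of `ϖ`.
      by_contra! hall
      obtain ⟨f, hf, hf0⟩ := Submodule.exists_mem_ne_zero_of_ne_bot hpS
      have hdvd : ∀ (m : ℕ) (g : R⟦X⟧), g ∈ p.comap (algebraMap R⟦X⟧ B) →
          ∀ j, ϖ ^ m ∣ PowerSeries.coeff j g := by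
        intro m
        induction m with
        | zero => intro g _ j; simp
        | succ m ih =>
          intro g hg j
          obtain ⟨g', rfl⟩ := PowerSeries.exists_eq_C_mul_of_map_eq_zero
            (k := IsLocalRing.ResidueField R) (ϖ := ϖ) (fun r => by
              rw [IsLocalRing.ResidueField.algebraMap_eq, IsLocalRing.residue_eq_zero_iff,
                hirr.maximalIdeal_eq, Ideal.mem_span_singleton]) g (hall g hg)
          rw [PowerSeries.coeff_C_mul, pow_succ']
          exact mul_dvd_mul_left _ (ih g' ((hprime.mem_or_mem hg).resolve_left hϖp) j)
      refine hf0 (PowerSeries.ext fun j => ?_)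
      rw [map_zero]
      by_contra hne
      obtain ⟨m, hm⟩ := FiniteMultiplicity.of_not_isUnit hirr.not_isUnit hne
      exact hm (hdvd (m + 1) f hf j)
    have hfin : Module.Finite R (B ⧸ p) := by
      refine PowerSeries.finite_of_smul_eq_zero f hf0 fun q => ?_
      obtain ⟨q, rfl⟩ := Ideal.Quotient.mk_surjective q
      have : f • Ideal.Quotient.mk p q = Ideal.Quotient.mk p (f • q) := rfl
      rw [this, Ideal.Quotient.eq_zero_iff_mem, Algebra.smul_def]
      exact p.mul_mem_right _ hf
    have hint : Algebra.IsIntegral K ((K ⊗[R] B) ⧸ P) := by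
      refine ⟨fun x => ?_⟩
      obtain ⟨x, rfl⟩ := Ideal.Quotient.mk_surjective x
      induction x with
      | zero => rw [map_zero]; exact isIntegral_zero
      | add x y hx hy => rw [map_add]; exact hx.add hy
      | tmul a y =>
        have h1 : IsIntegral R (Ideal.Quotient.mk p y) := Algebra.IsIntegral.isIntegral _
        let ψ : (B ⧸ p) →ₐ[R] ((K ⊗[R] B) ⧸ P) :=
          Ideal.quotientMapₐ P (Algebra.TensorProduct.includeRight : B →ₐ[R] K ⊗[R] B) le_rfl
        have h2 : IsIntegral K (ψ (Ideal.Quotient.mk p y)) := (h1.map ψ).tower_top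
        have h3 : Ideal.Quotient.mk P (a ⊗ₜ y) = a • ψ (Ideal.Quotient.mk p y) := by
          change _ = a • Ideal.Quotient.mk P (1 ⊗ₜ y)
          rw [← Ideal.Quotient.mk_eq_mk, ← Ideal.Quotient.mk_eq_mk, ← Submodule.Quotient.mk_smul,
            TensorProduct.smul_tmul', smul_eq_mul, mul_one]
        rw [h3]
        exact h2.smul a
    exact Ideal.Quotient.maximal_of_isField _
      (isField_of_isIntegral_of_isField' (R := K) (Field.toIsField K))⟩
  exact { }

/-! ### Comparison of the differents of the two fibres -/

section

attribute [local instance] FractionRing.liftAlgebra FractionRing.isScalarTower_liftAlgebra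

theorem IsGExtension.finrank_eq {G A B : Type*} [Group G] [CommRing A] [IsDomain A] [CommRing B]
    [IsDomain B] [Algebra A B] [Module.IsTorsionFree A B] [MulSemiringAction G B] [Finite G]
    (h : IsGExtension G A B) :
    Module.finrank (FractionRing A) (FractionRing B) = Nat.card G := by
  let _ := IsFractionRing.mulSemiringAction G B (FractionRing B)
  have := h.isGaloisGroup
  exact (IsGaloisGroup.card_eq_finrank G (FractionRing A) (FractionRing B)).symm

theorem IsGExtension.isGalois {G A B : Type*} [Group G] [CommRing A] [IsDomain A] [CommRing B]
    [IsDomain B] [Algebra A B] [Module.IsTorsionFree A B] [MulSemiringAction G B] [Finite G]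
    (h : IsGExtension G A B) : IsGalois (FractionRing A) (FractionRing B) := by
  let _ := IsFractionRing.mulSemiringAction G B (FractionRing B)
  have := h.isGaloisGroup
  exact IsGaloisGroup.isGalois G (FractionRing A) (FractionRing B)

theorem IsGExtension.isDedekindDomain {G A B : Type*} [Group G] [CommRing A] [IsDomain A]
    [IsDedekindRing A] [CommRing B]
    [IsDomain B] [Algebra A B] [Module.IsTorsionFree A B] [MulSemiringAction G B]
    (h : IsGExtension G A B) : IsDedekindDomain B := by
  have := h.finite
  have := h.isIntegrallyClosed
  have := Ring.DimensionLEOne.of_isIntegral A B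
  have : IsNoetherianRing B := IsNoetherianRing.of_finite A B
  exact { }

theorem FractionRing.finrank_eq (A B : Type*) [CommRing A] [IsDomain A] [CommRing B]
    [IsDomain B] [Algebra A B] [Module.IsTorsionFree A B] [Module.Finite A B] :
    Module.finrank (FractionRing A) (FractionRing B) = Module.finrank A B := by
  exact IsFractionRing.finrank_eq A (FractionRing A) B (FractionRing B)

/-- For a free extension `E / A₀` with `E` a Dedekind domain, the degree of the different is the
length of the cokernel of the trace matrix. -/
theorem differentDegree_eq_length_coker {F A₀ E ι : Type*} [Field F] [CommRing A₀] [IsDomain A₀]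
    [CommRing E] [IsDedekindDomain E] [Algebra A₀ E] [Module.IsTorsionFree A₀ E] [Algebra F A₀]
    [Algebra F E] [IsScalarTower F A₀ E] [Fintype ι] [DecidableEq ι] (b : Module.Basis ι A₀ E)
    (M : Matrix ι ι A₀) (hM : ∀ i j, M i j = Algebra.trace A₀ E (b i * b j)) (hdet : M.det ≠ 0) :
    differentDegree F A₀ E = Module.length F ((ι → A₀) ⧸ LinearMap.range M.mulVecLin) := by
  have : Module.Finite A₀ E := Module.Finite.of_basis b
  obtain ⟨c, hc⟩ := b.linearIndependent.exists_basis_fractionRing _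
    (by rw [FractionRing.finrank_eq, Module.finrank_eq_card_basis b])
  have htr : ∀ x : E, Algebra.trace (FractionRing A₀) (FractionRing E)
      (algebraMap E (FractionRing E) x) =
        algebraMap A₀ (FractionRing A₀) (Algebra.trace A₀ E x) := fun x =>
    Algebra.trace_map_of_basis (algebraMap A₀ (FractionRing A₀)) (algebraMap E (FractionRing E))
      (fun s => by rw [← IsScalarTower.algebraMap_apply, ← IsScalarTower.algebraMap_apply]) b c hc x
  refine (differentDegree_le_length_coker b c hc (fun x => ⟨_, (htr x).symm⟩) M hdet
    fun i j => ?_).2.1 b.span_eq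
  rw [hM, hc, hc, ← htr, map_mul]

/-- Degrees of the differents of the special and the generic fibre of a finite normal
`R⟦X⟧`-algebra `B` whose reduction is embedded in the `G`-extension `A / k⟦X⟧`. -/
theorem differentDegree_special_le_generic {G R k K A B : Type*} [Group G] [Finite G]
    [CommRing R] [IsDomain R] [IsDiscreteValuationRing R]
    [IsAdicComplete (IsLocalRing.maximalIdeal R) R]
    [Field k] [Algebra R k] [Field K] [Algebra R K] [IsFractionRing R K]
    {ϖ : R} (hirr : Irreducible ϖ) (hϖ : ∀ r : R, algebraMap R k r = 0 ↔ ϖ ∣ r)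
    (hsurj : Function.Surjective (algebraMap R k))
    [CommRing A] [IsDomain A] [Algebra k⟦X⟧ A] [Module.IsTorsionFree k⟦X⟧ A]
    [MulSemiringAction G A] [Algebra k A] [IsScalarTower k k⟦X⟧ A] (hA : IsGExtension G k⟦X⟧ A)
    [CommRing B] [IsDomain B] [Algebra R⟦X⟧ B] [Module.IsTorsionFree R⟦X⟧ B]
    [MulSemiringAction G B] [Algebra R B] [IsScalarTower R R⟦X⟧ B] [Module.IsTorsionFree R B]
    (hB : IsGExtension G R⟦X⟧ B) (ψ : k ⊗[R] B →+* A) (hψinj : Function.Injective ψ)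
    (hψ : ∀ f : R⟦X⟧, ψ (1 ⊗ₜ algebraMap R⟦X⟧ B f) =
      algebraMap k⟦X⟧ A (PowerSeries.map (algebraMap R k) f)) :
    differentDegree K (K ⊗[R] R⟦X⟧) (K ⊗[R] B) ≠ ⊤ ∧
    differentDegree k k⟦X⟧ A ≤ differentDegree K (K ⊗[R] R⟦X⟧) (K ⊗[R] B) ∧
    (differentDegree k k⟦X⟧ A = differentDegree K (K ⊗[R] R⟦X⟧) (K ⊗[R] B) ↔
      Function.Surjective ψ) := by
  have := hA.finite
  have := hB.finite
  have := hB.isIntegrallyClosed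
  have := hA.isGalois
  have := hA.isDedekindDomain
  have := genericFiber_isDedekindDomain R K B
  have := genericFiber_isScalarTower R K R⟦X⟧ B
  let ιB : B →+* k ⊗[R] B := (Algebra.TensorProduct.includeRight : B →ₐ[R] k ⊗[R] B).toRingHom
  let φ : B →+* A := ψ.comp ιB
  let red : R⟦X⟧ →+* k⟦X⟧ := PowerSeries.map (algebraMap R k)
  have hφ : ∀ s, φ (algebraMap R⟦X⟧ B s) = algebraMap k⟦X⟧ A (red s) := hψ
  have hker : ∀ b, φ b = 0 → ∃ b', b = (PowerSeries.C ϖ : R⟦X⟧) • b' := fun b hb => by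
    have h1 : (1 : k) ⊗ₜ[R] b = 0 := hψinj (hb.trans (map_zero ψ).symm)
    obtain ⟨b', rfl⟩ := TensorProduct.exists_eq_smul_of_one_tmul_eq_zero hϖ hsurj b h1
    exact ⟨b', by rw [← algebraMap_smul R⟦X⟧ ϖ b']; rfl⟩
  obtain ⟨n, b, hli⟩ := PowerSeries.exists_basis_of_reduction hirr hϖ hsurj φ hφ hker
  -- Both extensions have degree `|G|`, so the independent family `φ ∘ b` has the size of a basis of
  -- `Frac A`.
  have hcard : Fintype.card (Fin n) =
      Module.finrank (FractionRing k⟦X⟧) (FractionRing A) := by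
    rw [hA.finrank_eq, ← hB.finrank_eq, FractionRing.finrank_eq, Module.finrank_eq_card_basis b]
  obtain ⟨c, hc⟩ := hli.exists_basis_fractionRing _ hcard
  let M : Matrix (Fin n) (Fin n) R⟦X⟧ := fun i j => Algebra.trace R⟦X⟧ B (b i * b j)
  have hM : ∀ i j, algebraMap k⟦X⟧ (FractionRing k⟦X⟧) ((M.map red) i j) =
      Algebra.trace (FractionRing k⟦X⟧) (FractionRing A) (c i * c j) := fun i j => by
    have := Algebra.trace_map_of_basis ((algebraMap k⟦X⟧ (FractionRing k⟦X⟧)).comp red)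
      ((algebraMap A (FractionRing A)).comp φ) (fun s => by
        rw [RingHom.comp_apply, hφ, RingHom.comp_apply, ← IsScalarTower.algebraMap_apply,
          ← IsScalarTower.algebraMap_apply]) b c hc (b i * b j)
    rw [map_mul] at this
    rw [hc, hc]
    exact this.symm
  -- Separability of `Frac A` enters here, as nondegeneracy of the trace form.
  have hdet : (M.map red).det ≠ 0 := fun h0 => by
    have h1 := (LinearMap.BilinForm.nondegenerate_iff_det_ne_zero c).1
      (traceForm_nondegenerate (FractionRing k⟦X⟧) (FractionRing A))
    have h2 : LinearMap.BilinForm.toMatrix c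
        (Algebra.traceForm (FractionRing k⟦X⟧) (FractionRing A)) =
        (M.map red).map (algebraMap k⟦X⟧ (FractionRing k⟦X⟧)) := by
      ext i j
      rw [LinearMap.BilinForm.toMatrix_apply, Matrix.map_apply]
      exact (hM i j).symm
    rw [h2, ← RingHom.mapMatrix_apply, ← RingHom.map_det, h0, map_zero] at h1
    exact h1 rfl
  obtain ⟨r, hrk, hrK⟩ := PowerSeries.exists_length_coker_eq hirr hϖ hsurj M hdet K
  have htrA : ∀ x : A, Algebra.trace (FractionRing k⟦X⟧) (FractionRing A)
      (algebraMap A (FractionRing A) x) ∈ (algebraMap k⟦X⟧ (FractionRing k⟦X⟧)).range := fun x =>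
    IsIntegrallyClosed.isIntegral_iff.1 (Algebra.isIntegral_trace
      ((Algebra.IsIntegral.isIntegral (R := k⟦X⟧) x).algebraMap))
  obtain ⟨hle, heq1, heq2⟩ := differentDegree_le_length_coker (F := k) (φ ∘ b) c hc htrA
    (M.map red) hdet hM
  rw [hrk] at hle heq1 heq2
  obtain ⟨b', hb'⟩ := genericFiber_exists_basis R K R⟦X⟧ B b
  let inc : R⟦X⟧ →+* K ⊗[R] R⟦X⟧ :=
    (Algebra.TensorProduct.includeRight : R⟦X⟧ →ₐ[R] K ⊗[R] R⟦X⟧).toRingHom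
  let incB : B →+* K ⊗[R] B := (Algebra.TensorProduct.includeRight : B →ₐ[R] K ⊗[R] B).toRingHom
  have hM' : ∀ i j, (M.map inc) i j = Algebra.trace (K ⊗[R] R⟦X⟧) (K ⊗[R] B) (b' i * b' j) :=
    fun i j => by
      have := Algebra.trace_map_of_basis inc incB (fun s => rfl) b b' hb' (b i * b j)
      rw [map_mul] at this
      rw [hb', hb']
      exact this.symm
  have hinc : Function.Injective inc :=
    Algebra.TensorProduct.includeRight_injective (IsFractionRing.injective R K)
  have hdet' : (M.map inc).det ≠ 0 := by
    rw [← RingHom.mapMatrix_apply, ← RingHom.map_det, map_ne_zero_iff inc hinc]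
    intro h0
    rw [← RingHom.mapMatrix_apply, ← RingHom.map_det, h0, map_zero] at hdet
    exact hdet rfl
  have hη : differentDegree K (K ⊗[R] R⟦X⟧) (K ⊗[R] B) = r :=
    (differentDegree_eq_length_coker b' (M.map inc) hM' hdet').trans hrK
  rw [hη]
  refine ⟨ENat.natCast_ne_top r, hle, ?_⟩
  have hιB : Function.Surjective ιB := fun x => by
    induction x with
    | zero => exact ⟨0, map_zero _⟩
    | add x y hx hy =>
      obtain ⟨s, rfl⟩ := hx
      obtain ⟨t, rfl⟩ := hy
      exact ⟨s + t, map_add _ _ _⟩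
    | tmul a y =>
      obtain ⟨s, rfl⟩ := hsurj a
      refine ⟨s • y, ?_⟩
      change (1 : k) ⊗ₜ[R] (s • y) = _
      rw [TensorProduct.tmul_smul, TensorProduct.smul_tmul', Algebra.smul_def, mul_one]
  -- Since `B` maps onto `k ⊗ B`, surjectivity of `ψ` says that the `φ (b i)` span `A`.
  have hφψ : Function.Surjective ψ ↔ Function.Surjective φ :=
    ⟨fun h => h.comp hιB, fun h x => (h x).imp' ιB fun _ hy => hy⟩
  rw [hφψ]
  have hsm : ∀ (s : R⟦X⟧) (y : B), φ (s • y) = red s • φ y :=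
    fun s y => by rw [Algebra.smul_def, map_mul, hφ, Algebra.smul_def]
  constructor
  · intro h x
    have hx : x ∈ Submodule.span k⟦X⟧ (Set.range (φ ∘ b)) :=
      heq2 (ENat.natCast_ne_top r) h ▸ trivial
    obtain ⟨s, rfl⟩ := (Submodule.mem_span_range_iff_exists_fun _).1 hx
    choose t ht using fun i => PowerSeries.map_surjective _ hsurj (s i)
    refine ⟨∑ i, t i • b i, ?_⟩
    rw [map_sum]
    exact Finset.sum_congr rfl fun i _ => by rw [hsm, ← ht]; rfl
  · intro h
    refine heq1 (eq_top_iff.2 fun x _ => ?_)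
    obtain ⟨y, rfl⟩ := h x
    rw [← b.sum_repr y, map_sum]
    refine Submodule.sum_mem _ fun i _ => ?_
    rw [hsm]
    exact Submodule.smul_mem _ _ (Submodule.subset_span ⟨i, rfl⟩)

end

/-! ### The different criterion -/

theorem proposition4p3
    -- the ground field `k` and a finite extension `R` of `W(k)`, with `K = Frac R`
    (p : ℕ) [Fact p.Prime] (k : Type*) [Field k] [IsAlgClosed k] [CharP k p]
    (R : Type*) [CommRing R] [IsDomain R] [IsDiscreteValuationRing R]
    [Algebra (WittVector p k) R] [Module.IsTorsionFree (WittVector p k) R]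
    [Module.Finite (WittVector p k) R]
    (K : Type*) [Field K] [Algebra R K] [IsFractionRing R K]
    -- the residue map `R → k`: the unique one that extends `W(k) → k`
    [Algebra R k]
    (hRk : ∀ x : WittVector p k, algebraMap R k (algebraMap (WittVector p k) R x) = x.coeff 0)
    (G : Type*) [Group G] [Finite G]
    -- the `G`-extension `A / k⟦t⟧`
    (A : Type*) [CommRing A] [IsDomain A] [Algebra (PowerSeries k) A]
    [Module.IsTorsionFree (PowerSeries k) A] [MulSemiringAction G A]
    [Algebra k A] [IsScalarTower k (PowerSeries k) A]
    (hA : IsGExtension G (PowerSeries k) A)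
    -- the birational lift `AR / R⟦T⟧` (torsion-freeness over `R` follows from that over `R⟦T⟧`)
    (AR : Type*) [CommRing AR] [IsDomain AR] [Algebra (PowerSeries R) AR]
    [Module.IsTorsionFree (PowerSeries R) AR] [MulSemiringAction G AR]
    [Algebra R AR] [IsScalarTower R (PowerSeries R) AR] [Module.IsTorsionFree R AR]
    (hAR : IsBirationalLift G R k AR A)
    -- the degrees of the differents of the special and of the generic fibre
    (δs δη : ℕ∞)
    (hδs : δs = differentDegree k (PowerSeries k) A)
    (hδη : δη = differentDegree K (K ⊗[R] PowerSeries R) (K ⊗[R] AR)) :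
    δη ≠ ⊤ ∧ δs ≤ δη ∧ (δs = δη ↔ IsLift G R k AR A) := by
  -- Teichmüller representatives lift the elements of `k`; so the kernel of `R → k` is the maximal
  -- ideal.
  have hsurj : Function.Surjective (algebraMap R k) := fun a =>
    ⟨algebraMap (WittVector p k) R (WittVector.teichmuller p a), by
      rw [hRk, WittVector.teichmuller_coeff_zero]⟩
  have hker : RingHom.ker (algebraMap R k) = IsLocalRing.maximalIdeal R :=
    IsLocalRing.eq_maximalIdeal (RingHom.ker_isMaximal_of_surjective _ hsurj)
  obtain ⟨ϖ, hirr⟩ := IsDiscreteValuationRing.exists_irreducible R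
  have hϖ : ∀ r : R, algebraMap R k r = 0 ↔ ϖ ∣ r := fun r => by
    rw [← RingHom.mem_ker, hker, hirr.maximalIdeal_eq, Ideal.mem_span_singleton]
  have hmap : (Ideal.span {(p : WittVector p k)}).map (algebraMap (WittVector p k) R) =
      Ideal.span {(p : R)} := by
    rw [Ideal.map_span, Set.image_singleton, map_natCast]
  have : IsAdicComplete (IsLocalRing.maximalIdeal R) R := by
    refine IsDiscreteValuationRing.isAdicComplete_of_finite
      (Ideal.span {(p : WittVector p k)}) ?_ ?_
    · rw [hmap, Ne, Ideal.span_singleton_eq_bot,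
        ← map_natCast (algebraMap (WittVector p k) R), FaithfulSMul.algebraMap_eq_zero_iff]
      exact WittVector.p_nonzero p k
    · rw [hmap, Ideal.span_singleton_le_iff_mem, ← hker, RingHom.mem_ker, map_natCast,
        CharP.cast_eq_zero]
  -- `ψ` is left free because two maps are used: the embedding from the birational lift, and the
  -- isomorphism from a lift, which need not be the same map.
  have main := fun (ψ : k ⊗[R] AR →+* A) => differentDegree_special_le_generic (K := K) hirr hϖ
    hsurj hA hAR.isGExtension ψ
  obtain ⟨e, he, heG⟩ := hAR.exists_equiv
  let ψ : k ⊗[R] AR →+* A := (e : _ →+* A).comp (algebraMap (k ⊗[R] AR)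
    (integralClosure (k ⊗[R] AR) (FractionRing (k ⊗[R] AR))))
  have hinj : Function.Injective ψ := by
    refine e.injective.comp fun x y hxy => ?_
    exact IsFractionRing.injective (k ⊗[R] AR) (FractionRing (k ⊗[R] AR))
      (congrArg Subtype.val hxy)
  obtain ⟨h1, h2, h3⟩ := main ψ hinj he
  subst hδs hδη
  refine ⟨h1, h2, fun h => ?_, fun h => ?_⟩
  · exact ⟨hAR.isGExtension, RingEquiv.ofBijective ψ ⟨hinj, h3.1 h⟩, he, heG⟩
  · obtain ⟨e', he', -⟩ := h.exists_equiv
    exact (main e'.toRingHom e'.injective he').2.2.2 e'.surjective
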